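/- Let $N$ be a finite non-empty set of agents (a coalition is any subset of $N$) and let $\mathrm{Prop}$ be a non-empty countable set of propositional variables. Let $\mathcal{L}_{\mathrm{Iab}}$ be the language $$\varphi ::= p \mid \neg\varphi \mid (\varphi\wedge\psi) \mid [C]\varphi \mid \mathrm{Iab}_C\varphi \qquad (p\in\mathrm{Prop},\ C\subseteq N),$$ with $\rightarrow,\leftrightarrow,\top,\bot$ defined as usual. A coalition model is $\mathcal{M}=(S,\{Act_i\}_{i\in N},o,V)$ with $S$ a non-empty set of states, each $Act_i$ a non-empty set of actions, $o:S\times\prod_{i\in N}Act_i\to S$ and $V:\mathrm{Prop}\to 2^S$. With $Act_C=\prod_{i\in C}Act_i$ and $\overline C=N\setminus C$, satisfaction is defined by: $\mathcal{M},s\models p$ iff $s\in V(p)$; the usual clauses for $\neg$ and $\wedge$; $\mathcal{M},s\models[C]\varphi$ iff there is $\sigma_C\in Act_C$ such that for all $\sigma_{\overline C}\in Act_{\overline C}$, $\mathcal{M},o(s,\sigma_C,\sigma_{\overline C})\models\varphi$; and $\mathcal{M},s\models\mathrm{Iab}_C\varphi$ iff $\mathcal{M},s\not\models[C]\varphi$.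 A formula is valid, $\models\varphi$, if it holds at every state of every coalition model. Let $\mathrm{CL}_{\mathrm{Iab}}$ be the Hilbert system over $\mathcal{L}_{\mathrm{Iab}}$ given by Pauly's axioms and rules for Coalition Logic together with the definitional axiom for inability, that is, with the axiom schemes - all propositional tautologies; - $[C]\top$; - $\neg[C]\bot$; - $[C](\varphi\wedge\psi)\rightarrow[C]\psi$; - $([C]\varphi\wedge[D]\psi)\rightarrow[C\cup D](\varphi\wedge\psi)$ whenever $C\cap D=\emptyset$; - $\neg[\emptyset]\neg\varphi\rightarrow[N]\varphi$; - $\mathrm{Iab}_C\varphi\leftrightarrow\neg[C]\varphi$; and the rules modus ponens and: from $\vdash\varphi\leftrightarrow\psi$ infer $\vdash[C]\varphi\leftrightarrow[C]\psi$. Then for every $\varphi\in\mathcal{L}_{\mathrm{Iab}}$, $$\mathrm{CL}_{\mathrm{Iab}}\vdash\varphi\quad\text{iff}\quad\models\varphi.$$ -/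

import Mathlib

universe u v w

namespace CoalitionLogic

/-- Formulas of Coalition Logic extended with the inability operator.  `Ag` is the set of agents,
`P` the set of propositional variables, and a coalition is any subset of `Ag`. -/
inductive Formula (Ag : Type u) (P : Type v) : Type (max u v) where
  | var (p : P) : Formula Ag P
  | neg (φ : Formula Ag P) : Formula Ag P
  | conj (φ ψ : Formula Ag P) : Formula Ag P
  /-- `eff C φ` : coalition `C` can ensure `φ`. -/
  | eff (C : Set Ag) (φ : Formula Ag P) : Formula Ag P
  /-- `iab C φ` : coalition `C` is unable to ensure `φ`. -/
  | iab (C : Set Ag) (φ : Formula Ag P) : Formula Ag P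

namespace Formula

variable {Ag : Type u} {P : Type v}

/-- `φ → ψ`, as an abbreviation. -/
def imp (φ ψ : Formula Ag P) : Formula Ag P := neg (conj φ (neg ψ))

/-- `φ ↔ ψ`, as an abbreviation. -/
def iff (φ ψ : Formula Ag P) : Formula Ag P := conj (imp φ ψ) (imp ψ φ)

/-- `⊥`, as the abbreviation `p ∧ ¬p` for a fixed propositional variable `p`. -/
noncomputable def bot [Nonempty P] : Formula Ag P :=
  conj (var (Classical.arbitrary P)) (neg (var (Classical.arbitrary P)))

/-- `⊤`, as the abbreviation `¬⊥`. -/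
noncomputable def top [Nonempty P] : Formula Ag P := neg bot

/-- A truth assignment to all formulas that respects the two primitive Boolean connectives
(and treats variables and modal formulas as independent propositional atoms). -/
structure IsBooleanAssignment (v : Formula Ag P → Prop) : Prop where
  neg_iff : ∀ φ, v (neg φ) ↔ ¬ v φ
  conj_iff : ∀ φ ψ, v (conj φ ψ) ↔ (v φ ∧ v ψ)

/-- Propositional tautologies of the extended language. -/
def IsTautology (φ : Formula Ag P) : Prop :=
  ∀ v : Formula Ag P → Prop, IsBooleanAssignment v → v φ

end Formula

open Formula

/-- Coalition models: one-step concurrent games with a valuation. -/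
structure CoalitionModel (Ag : Type u) (P : Type v) where
  State : Type w
  state_nonempty : Nonempty State
  Act : Ag → Type w
  act_nonempty : ∀ i, Nonempty (Act i)
  outcome : State → (∀ i, Act i) → State
  val : P → Set State

namespace CoalitionModel

variable {Ag : Type u} {P : Type v}

/-- Joint actions of the coalition `C`. -/
def JointAction (M : CoalitionModel.{u, v, w} Ag P) (C : Set Ag) : Type (max u w) :=
  ∀ i : C, M.Act i

open Classical in
/-- The complete action profile in which `C` plays `σ` and the complement of `C` plays `τ`. -/
noncomputable def combine (M : CoalitionModel.{u, v, w} Ag P) {C : Set Ag}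
    (σ : M.JointAction C) (τ : M.JointAction Cᶜ) : ∀ i, M.Act i :=
  fun i => if h : i ∈ C then σ ⟨i, h⟩ else τ ⟨i, h⟩

/-- Satisfaction of a formula at a state. -/
def Sat (M : CoalitionModel.{u, v, w} Ag P) : M.State → Formula Ag P → Prop
  | s, .var p => s ∈ M.val p
  | s, .neg φ => ¬ M.Sat s φ
  | s, .conj φ ψ => M.Sat s φ ∧ M.Sat s ψ
  | s, .eff C φ =>
      ∃ σ : M.JointAction C, ∀ τ : M.JointAction Cᶜ, M.Sat (M.outcome s (M.combine σ τ)) φ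
  | s, .iab C φ =>
      ¬ ∃ σ : M.JointAction C, ∀ τ : M.JointAction Cᶜ, M.Sat (M.outcome s (M.combine σ τ)) φ

end CoalitionModel

/-- Validity: truth at every state of every coalition model. -/
def Valid {Ag : Type u} {P : Type v} (φ : Formula Ag P) : Prop :=
  ∀ (M : CoalitionModel.{u, v, w} Ag P) (s : M.State), M.Sat s φ

/-- Derivability in the Hilbert system consisting of Pauly's axioms and rules for Coalition Logic,
applied to all formulas of the extended language, and the definitional axiom for inability. -/
inductive Provable {Ag : Type u} {P : Type v} [Nonempty P] : Formula Ag P → Prop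
  /-- All propositional tautologies. -/
  | taut {φ : Formula Ag P} (h : IsTautology φ) : Provable φ
  /-- Every coalition can ensure truth. -/
  | eff_top (C : Set Ag) : Provable (eff C top)
  /-- No coalition can ensure a contradiction. -/
  | not_eff_bot (C : Set Ag) : Provable (neg (eff C bot))
  /-- Outcome monotonicity. -/
  | mono (C : Set Ag) (φ ψ : Formula Ag P) : Provable (imp (eff C (conj φ ψ)) (eff C ψ))
  /-- Superadditivity for disjoint coalitions. -/
  | superadd (C D : Set Ag) (h : C ∩ D = ∅) (φ ψ : Formula Ag P) :
      Provable (imp (conj (eff C φ) (eff D ψ)) (eff (C ∪ D) (conj φ ψ)))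
  /-- Power of the grand coalition. -/
  | grand (φ : Formula Ag P) : Provable (imp (neg (eff ∅ (neg φ))) (eff Set.univ φ))
  /-- Definitional axiom for inability. -/
  | iab_def (C : Set Ag) (φ : Formula Ag P) : Provable (iff (iab C φ) (neg (eff C φ)))
  /-- Modus ponens. -/
  | mp {φ ψ : Formula Ag P} (h₁ : Provable φ) (h₂ : Provable (imp φ ψ)) : Provable ψ
  /-- Replacement of provable equivalents. -/
  | re (C : Set Ag) {φ ψ : Formula Ag P} (h : Provable (iff φ ψ)) :
      Provable (iff (eff C φ) (eff C ψ))

end CoalitionLogic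

namespace CoalitionLogic

open Formula

/-! ### Semantics and soundness. -/

section Semantics

variable {Ag : Type u} {P : Type v}

namespace CoalitionModel

/-! Soundness is an induction on derivations. Completeness uses a canonical game whose states are
the maximal consistent sets. Each agent names a coalition, a goal, a vote and a target world. A
nonempty coalition is formed when all its members name it with one common goal that it can ensure at
the current world. Formed coalitions are disjoint, so superadditivity lets their union ensure all
goals jointly (`exists_eff_goals`), and some successor meets them all. The play moves to the elected
leader's target if that world is such a successor, and otherwise to an arbitrary one. A coalition
able to ensure `φ` enforces it by forming with goal `φ`. If `C` is unable and not everyone, the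
outsiders join nothing, and one of them gets elected and targets a compatible world refuting `φ`. If
`C` is everyone, the grand coalition axiom makes `¬φ` unavoidable. This is `World.holds_eff_iff`,
the modal case of the truth lemma. -/

theorem sat_imp (M : CoalitionModel.{u, v, w} Ag P) (s : M.State) (φ ψ : Formula Ag P) :
    M.Sat s (imp φ ψ) ↔ (M.Sat s φ → M.Sat s ψ) := by
  simp only [imp, Sat]
  tauto

theorem sat_iff (M : CoalitionModel.{u, v, w} Ag P) (s : M.State) (φ ψ : Formula Ag P) :
    M.Sat s (iff φ ψ) ↔ (M.Sat s φ ↔ M.Sat s ψ) := by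
  have h : M.Sat s (iff φ ψ) ↔ M.Sat s (imp φ ψ) ∧ M.Sat s (imp ψ φ) := by
    simp only [iff, Sat]
  rw [h, sat_imp, sat_imp]
  tauto

theorem not_sat_bot [Nonempty P] (M : CoalitionModel.{u, v, w} Ag P) (s : M.State) :
    ¬ M.Sat s bot := by
  simp only [bot, Sat]
  tauto

theorem sat_top [Nonempty P] (M : CoalitionModel.{u, v, w} Ag P) (s : M.State) :
    M.Sat s top := by
  simp only [top, Sat]
  exact M.not_sat_bot s

theorem isBooleanAssignment_sat (M : CoalitionModel.{u, v, w} Ag P) (s : M.State) :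
    IsBooleanAssignment (M.Sat s) :=
  ⟨fun φ => by simp only [Sat], fun φ ψ => by simp only [Sat]⟩

/-- Effectivity in terms of full action profiles that agree on the coalition. -/
theorem sat_eff_iff (M : CoalitionModel.{u, v, w} Ag P) (s : M.State) (C : Set Ag)
    (φ : Formula Ag P) :
    M.Sat s (eff C φ) ↔
      ∃ a : ∀ i, M.Act i, ∀ b : ∀ i, M.Act i, (∀ i ∈ C, b i = a i) →
        M.Sat (M.outcome s b) φ := by
  classical
  simp only [Sat]
  constructor
  · rintro ⟨σ, hσ⟩
    refine ⟨M.combine σ fun i => (M.act_nonempty i).some, fun b hb => ?_⟩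
    have hcomb : M.combine σ (fun i => b i) = b := by
      funext i
      by_cases hi : i ∈ C
      · rw [hb i hi]
        simp [combine, hi]
      · simp [combine, hi]
    rw [← hcomb]
    exact hσ _
  · rintro ⟨a, ha⟩
    refine ⟨fun i => a i, fun τ => ha _ fun i hi => ?_⟩
    simp [combine, hi]

theorem sat_iab_iff (M : CoalitionModel.{u, v, w} Ag P) (s : M.State) (C : Set Ag)
    (φ : Formula Ag P) : M.Sat s (iab C φ) ↔ ¬ M.Sat s (eff C φ) := by
  simp only [Sat]

end CoalitionModel

theorem Provable.valid [Nonempty P] {φ : Formula Ag P} (h : Provable φ) :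
    Valid.{u, v, w} φ := by
  classical
  induction h with
  | taut h => exact fun M s => h _ (M.isBooleanAssignment_sat s)
  | eff_top C =>
    intro M s
    rw [M.sat_eff_iff]
    exact ⟨fun i => (M.act_nonempty i).some, fun b _ => M.sat_top _⟩
  | not_eff_bot C =>
    intro M s
    rw [(M.isBooleanAssignment_sat s).neg_iff, M.sat_eff_iff]
    rintro ⟨a, ha⟩
    exact M.not_sat_bot _ (ha a fun _ _ => rfl)
  | mono C φ ψ =>
    intro M s
    rw [M.sat_imp, M.sat_eff_iff, M.sat_eff_iff]
    rintro ⟨a, ha⟩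
    exact ⟨a, fun b hb => (((M.isBooleanAssignment_sat _).conj_iff _ _).1 (ha b hb)).2⟩
  | superadd C D h φ ψ =>
    intro M s
    rw [M.sat_imp, (M.isBooleanAssignment_sat s).conj_iff, M.sat_eff_iff, M.sat_eff_iff,
      M.sat_eff_iff]
    rintro ⟨⟨a, ha⟩, ⟨a', ha'⟩⟩
    refine ⟨fun i => if i ∈ C then a i else a' i, fun b hb => ?_⟩
    rw [(M.isBooleanAssignment_sat _).conj_iff]
    refine ⟨ha b fun i hi => ?_, ha' b fun i hi => ?_⟩
    · exact (hb i (Or.inl hi)).trans (if_pos hi)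
    · have hiC : i ∉ C := fun hC => (h ▸ (⟨hC, hi⟩ : i ∈ C ∩ D) : i ∈ (∅ : Set Ag))
      exact (hb i (Or.inr hi)).trans (if_neg hiC)
  | grand φ =>
    intro M s
    rw [M.sat_imp, (M.isBooleanAssignment_sat s).neg_iff, M.sat_eff_iff, M.sat_eff_iff]
    intro h
    by_contra hcon
    refine h ⟨fun i => (M.act_nonempty i).some, fun b _ => ?_⟩
    rw [(M.isBooleanAssignment_sat _).neg_iff]
    refine fun hb => hcon ⟨b, fun c hc => ?_⟩
    rwa [funext fun i => hc i (Set.mem_univ i)]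
  | iab_def C φ =>
    intro M s
    rw [M.sat_iff, M.sat_iab_iff, (M.isBooleanAssignment_sat s).neg_iff]
  | mp _ _ ih₁ ih₂ => exact fun M s => (M.sat_imp s _ _).1 (ih₂ M s) (ih₁ M s)
  | re C _ ih =>
    intro M s
    rw [M.sat_iff, M.sat_eff_iff, M.sat_eff_iff]
    simp only [fun t => (M.sat_iff t _ _).1 (ih M t)]

end Semantics

/-! ### Propositional theories and Lindenbaum's lemma. -/

section Propositional

variable {Ag : Type u} {P : Type v}

namespace Formula.IsBooleanAssignment

variable {f : Formula Ag P → Prop}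

theorem imp_iff (hf : IsBooleanAssignment f) (φ ψ : Formula Ag P) :
    f (imp φ ψ) ↔ (f φ → f ψ) := by
  simp only [imp, hf.neg_iff, hf.conj_iff]
  tauto

theorem iff_iff (hf : IsBooleanAssignment f) (φ ψ : Formula Ag P) :
    f (Formula.iff φ ψ) ↔ (f φ ↔ f ψ) := by
  simp only [Formula.iff, hf.imp_iff, hf.conj_iff]
  tauto

end Formula.IsBooleanAssignment

/-- A set of formulas that contains the tautologies and is closed under modus ponens. -/
structure IsTheory (T : Set (Formula Ag P)) : Prop where
  taut_mem : ∀ {φ}, IsTautology φ → φ ∈ T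
  mp_mem : ∀ {φ ψ}, φ ∈ T → imp φ ψ ∈ T → ψ ∈ T

namespace IsTheory

variable {T : Set (Formula Ag P)}

theorem mem_of_taut₂ (hT : IsTheory T) {φ ψ χ : Formula Ag P} (hφ : φ ∈ T) (hψ : ψ ∈ T)
    (h : IsTautology (imp φ (imp ψ χ))) : χ ∈ T :=
  hT.mp_mem hψ (hT.mp_mem hφ (hT.taut_mem h))

theorem mem_of_taut (hT : IsTheory T) {φ χ : Formula Ag P} (hφ : φ ∈ T)
    (h : IsTautology (imp φ χ)) : χ ∈ T :=
  hT.mp_mem hφ (hT.taut_mem h)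

/-- The theory obtained by adding one assumption. -/
theorem setOf_imp_mem (hT : IsTheory T) (ψ : Formula Ag P) : IsTheory {θ | imp ψ θ ∈ T} where
  taut_mem h := hT.taut_mem fun f hf => (hf.imp_iff _ _).2 fun _ => h f hf
  mp_mem h₁ h₂ := hT.mem_of_taut₂ h₁ h₂ fun f hf => by
    simp only [hf.imp_iff]
    tauto

theorem sUnion {c : Set (Set (Formula Ag P))} (hc : IsChain (· ⊆ ·) c) (hne : c.Nonempty)
    (h : ∀ T ∈ c, IsTheory T) : IsTheory (⋃₀ c) where
  taut_mem hφ := by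
    obtain ⟨T, hT⟩ := hne
    exact ⟨T, hT, (h T hT).taut_mem hφ⟩
  mp_mem := by
    rintro φ ψ ⟨T₁, hT₁, h₁⟩ ⟨T₂, hT₂, h₂⟩
    rcases hc.total hT₁ hT₂ with hle | hle
    · exact ⟨T₂, hT₂, (h T₂ hT₂).mp_mem (hle h₁) h₂⟩
    · exact ⟨T₁, hT₁, (h T₁ hT₁).mp_mem h₁ (hle h₂)⟩

/-- Lindenbaum's lemma. -/
theorem exists_isBooleanAssignment (hT : IsTheory T) {φ : Formula Ag P} (hφ : φ ∉ T) :
    ∃ f : Formula Ag P → Prop, IsBooleanAssignment f ∧ (∀ θ ∈ T, f θ) ∧ ¬ f φ := by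
  obtain ⟨M, hTM, hM⟩ := zorn_subset_nonempty {T | IsTheory T ∧ φ ∉ T}
    (fun c hc hchain hne => ⟨⋃₀ c,
      ⟨sUnion hchain hne fun T hT => (hc hT).1, by
        rintro ⟨T, hT, hmem⟩
        exact (hc hT).2 hmem⟩,
      fun T hT => Set.subset_sUnion_of_mem hT⟩) T ⟨hT, hφ⟩
  obtain ⟨hMT, hMφ⟩ := hM.prop
  have himp : ∀ ψ, ψ ∉ M → imp ψ φ ∈ M := by
    intro ψ hψ
    by_contra hcon
    have hsub : M ⊆ {θ | imp ψ θ ∈ M} := fun θ hθ => hMT.mem_of_taut hθ fun f hf => by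
      simp only [hf.imp_iff]
      tauto
    -- The theory generated by `M` and `ψ` still omits `φ`, so by maximality it is contained in `M`.
    refine hψ (hM.le_of_ge ⟨hMT.setOf_imp_mem ψ, hcon⟩ hsub ?_)
    exact hMT.taut_mem fun f hf => (hf.imp_iff _ _).2 id
  refine ⟨fun θ => θ ∈ M, ⟨fun ψ => ⟨fun h₁ h₂ => hMφ ?_, fun h => ?_⟩, fun ψ χ =>
    ⟨fun h => ⟨?_, ?_⟩, fun h => ?_⟩⟩, fun θ hθ => hTM hθ, hMφ⟩
  · exact hMT.mem_of_taut₂ h₁ h₂ fun f hf => by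
      simp only [hf.imp_iff, hf.neg_iff]
      tauto
  · by_contra hcon
    exact hMφ <| hMT.mem_of_taut₂ (himp _ h) (himp _ hcon) fun f hf => by
      simp only [hf.imp_iff, hf.neg_iff]
      tauto
  · exact hMT.mem_of_taut h fun f hf => by
      simp only [hf.imp_iff, hf.conj_iff]
      tauto
  · exact hMT.mem_of_taut h fun f hf => by
      simp only [hf.imp_iff, hf.conj_iff]
      tauto
  · exact hMT.mem_of_taut₂ h.1 h.2 fun f hf => by
      simp only [hf.imp_iff, hf.conj_iff]
      tauto

end IsTheory

end Propositional

/-! ### Maximal consistent sets and their successors. -/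

section Canonical

variable {Ag : Type u} {P : Type v} [Nonempty P]

theorem Provable.isTheory : IsTheory {φ : Formula Ag P | Provable φ} where
  taut_mem := .taut
  mp_mem := .mp

/-- Here `φ` is provably equivalent to `φ ∧ ψ`, so replacement of equivalents reduces the rule to
the monotonicity axiom. -/
theorem Provable.eff_imp_eff (C : Set Ag) {φ ψ : Formula Ag P} (h : Provable (imp φ ψ)) :
    Provable (imp (eff C φ) (eff C ψ)) := by
  have hiff : Provable (iff φ (conj φ ψ)) := Provable.isTheory.mem_of_taut h fun f hf => by
    simp only [hf.imp_iff, hf.iff_iff, hf.conj_iff]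
    tauto
  exact Provable.isTheory.mem_of_taut₂ (Provable.re C hiff) (Provable.mono C φ ψ) fun f hf => by
    simp only [hf.imp_iff, hf.iff_iff]
    tauto

variable (Ag P) in
/-- Maximal consistent sets of formulas, as Boolean assignments that verify every theorem. -/
structure World where
  holds : Formula Ag P → Prop
  isBooleanAssignment : IsBooleanAssignment holds
  holds_of_provable : ∀ {φ}, Provable φ → holds φ

namespace World

variable (s : World Ag P) {C D : Set Ag} {φ ψ χ : Formula Ag P}

theorem holds_injective : Function.Injective (World.holds : World Ag P → _) := by
  rintro ⟨f, _, _⟩ ⟨g, _, _⟩ rfl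
  rfl

theorem holds_mp (h : Provable (imp φ ψ)) (hφ : s.holds φ) : s.holds ψ :=
  (s.isBooleanAssignment.imp_iff _ _).1 (s.holds_of_provable h) hφ

theorem eff_mono (h : Provable (imp φ ψ)) (hφ : s.holds (eff C φ)) : s.holds (eff C ψ) :=
  s.holds_mp (h.eff_imp_eff C) hφ

theorem eff_top : s.holds (eff C top) := s.holds_of_provable (.eff_top C)

theorem not_eff_bot : ¬ s.holds (eff C bot) :=
  (s.isBooleanAssignment.neg_iff _).1 (s.holds_of_provable (.not_eff_bot C))

theorem eff_of_provable (h : Provable φ) : s.holds (eff C φ) :=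
  s.eff_mono (Provable.isTheory.mem_of_taut h fun f hf => by
    simp only [hf.imp_iff]
    tauto) s.eff_top

theorem eff_union (h : C ∩ D = ∅) (hφ : s.holds (eff C φ)) (hψ : s.holds (eff D ψ)) :
    s.holds (eff (C ∪ D) (conj φ ψ)) :=
  s.holds_mp (.superadd C D h φ ψ) ((s.isBooleanAssignment.conj_iff _ _).2 ⟨hφ, hψ⟩)

/-- Superadditivity, with `D \ C` ensuring only `⊤`. -/
theorem eff_of_subset (h : C ⊆ D) (hφ : s.holds (eff C φ)) : s.holds (eff D φ) := by
  have hunion := s.eff_union (D := D \ C) (by simp) hφ s.eff_top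
  rw [Set.union_sdiff_cancel h] at hunion
  refine s.eff_mono (.taut fun f hf => ?_) hunion
  simp only [hf.imp_iff, hf.conj_iff]
  tauto

theorem eff_of_eff_empty_imp (h : s.holds (eff ∅ (imp φ ψ))) (hφ : s.holds (eff C φ)) :
    s.holds (eff C ψ) := by
  have hunion := s.eff_union (Set.inter_empty C) hφ h
  rw [Set.union_empty] at hunion
  refine s.eff_mono (.taut fun f hf => ?_) hunion
  simp only [hf.imp_iff, hf.conj_iff]
  tauto

theorem eff_empty_neg (h : ¬ s.holds (eff Set.univ φ)) : s.holds (eff ∅ (neg φ)) := by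
  by_contra hcon
  exact h (s.holds_mp (.grand φ) ((s.isBooleanAssignment.neg_iff _).2 hcon))

theorem isTheory_eff_empty : IsTheory {θ | s.holds (eff ∅ θ)} where
  taut_mem h := s.eff_of_provable (.taut h)
  mp_mem h₁ h₂ := s.eff_of_eff_empty_imp h₂ h₁

/-- The possible successors of a world: those that contain everything that is unavoidable. -/
def Successor (t : World Ag P) : Prop := ∀ θ, s.holds (eff ∅ θ) → t.holds θ

/-- Lindenbaum's lemma for the theory of all `θ` with `χ → θ` unavoidable. It omits `φ`: otherwise
superadditivity of `C` with `∅` would let `C` ensure `φ`. -/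
theorem exists_successor (hχ : s.holds (eff C χ)) (hφ : ¬ s.holds (eff C φ)) :
    ∃ t : World Ag P, s.Successor t ∧ t.holds χ ∧ ¬ t.holds φ := by
  obtain ⟨f, hf, hT, hfφ⟩ := (s.isTheory_eff_empty.setOf_imp_mem χ).exists_isBooleanAssignment
    (φ := φ) fun h => hφ (s.eff_of_eff_empty_imp h hχ)
  have hsucc : ∀ θ, s.holds (eff ∅ θ) → f θ := fun θ hθ =>
    hT θ (s.eff_mono (.taut fun g hg => by
      simp only [hg.imp_iff]
      tauto) hθ)
  refine ⟨⟨f, hf, fun h => hsucc _ (s.eff_of_provable h)⟩, hsucc, hT χ ?_, hfφ⟩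
  exact s.eff_of_provable (.taut fun g hg => (hg.imp_iff _ _).2 id)

end World

theorem exists_world_not_holds {φ : Formula Ag P} (h : ¬ Provable φ) :
    ∃ s : World Ag P, ¬ s.holds φ := by
  obtain ⟨f, hf, hT, hfφ⟩ := Provable.isTheory.exists_isBooleanAssignment h
  exact ⟨⟨f, hf, fun h => hT _ h⟩, hfφ⟩

/-! ### The canonical game: moves, formed coalitions, compatible worlds. -/

variable (Ag P) in
/-- An action in the canonical game: a coalition to join, a formula that this coalition is to
enforce, a vote for the leader, and the world to move to in case of being the leader. -/
structure Move where
  coalition : Set Ag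
  goal : Formula Ag P
  vote : Ag
  target : World Ag P

namespace World

variable (s : World Ag P)

/-- The coalition `C` is formed in the profile `a` and pursues the goal `ψ`, which it is able to
ensure. -/
structure Formed (a : Ag → Move Ag P) (C : Set Ag) (ψ : Formula Ag P) : Prop where
  nonempty : C.Nonempty
  coalition_eq : ∀ i ∈ C, (a i).coalition = C
  goal_eq : ∀ i ∈ C, (a i).goal = ψ
  eff : s.holds (eff C ψ)

theorem Formed.disjoint {s : World Ag P} {a : Ag → Move Ag P} {C D : Set Ag}
    {φ ψ : Formula Ag P} (hC : s.Formed a C φ) (hD : s.Formed a D ψ) (hne : C ≠ D) :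
    Disjoint C D :=
  Set.disjoint_left.2 fun i hiC hiD => hne ((hC.coalition_eq i hiC).symm.trans
    (hD.coalition_eq i hiD))

theorem Formed.goal_unique {s : World Ag P} {a : Ag → Move Ag P} {C : Set Ag}
    {φ ψ : Formula Ag P} (hφ : s.Formed a C φ) (hψ : s.Formed a C ψ) : φ = ψ := by
  obtain ⟨i, hi⟩ := hφ.nonempty
  exact (hφ.goal_eq i hi).symm.trans (hψ.goal_eq i hi)

/-- Formed coalitions are pairwise disjoint, finite in number and each has a single goal, so
superadditivity can be iterated; `χ` is the conjunction of the goals. -/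
theorem exists_eff_goals [Finite Ag] (a : Ag → Move Ag P) (U : Set Ag)
    (hU : ∀ C ψ, s.Formed a C ψ → C ⊆ U) :
    ∃ χ, s.holds (eff U χ) ∧ ∀ C ψ, s.Formed a C ψ → Provable (imp χ ψ) := by
  classical
  have key : ∀ F : Set (Set Ag), F.Finite → (∀ C ∈ F, ∃ ψ, s.Formed a C ψ) →
      ∃ χ, s.holds (Formula.eff (⋃₀ F) χ) ∧
        ∀ C ∈ F, ∀ ψ, s.Formed a C ψ → Provable (imp χ ψ) := by
    intro F hF
    induction F, hF using Set.Finite.induction_on with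
    | empty => exact fun _ => ⟨top, s.eff_top, by simp⟩
    | @insert D F hD _ ih =>
      intro hform
      obtain ⟨χ, hχ, hgoal⟩ := ih fun C hC => hform C (Set.mem_insert_of_mem _ hC)
      obtain ⟨θ, hθ⟩ := hform D (Set.mem_insert _ _)
      have hdisj : Disjoint D (⋃₀ F) := Set.disjoint_sUnion_right.2 fun C hC => by
        obtain ⟨ψ, hψ⟩ := hform C (Set.mem_insert_of_mem _ hC)
        exact hθ.disjoint hψ fun h => hD (h ▸ hC)
      refine ⟨conj θ χ, ?_, fun C hC ψ hψ => ?_⟩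
      · rw [Set.sUnion_insert]
        exact s.eff_union hdisj.inter_eq hθ.eff hχ
      · rcases Set.mem_insert_iff.1 hC with rfl | hC
        · rw [hψ.goal_unique hθ]
          exact .taut fun f hf => by
            simp only [hf.imp_iff, hf.conj_iff]
            tauto
        · refine Provable.isTheory.mem_of_taut (hgoal C hC ψ hψ) fun f hf => ?_
          simp only [hf.imp_iff, hf.conj_iff]
          tauto
  obtain ⟨χ, hχ, hgoal⟩ := key {C | ∃ ψ, s.Formed a C ψ} (Set.toFinite _) fun C hC => hC
  exact ⟨χ, s.eff_of_subset (Set.sUnion_subset fun C hC => hC.elim (hU C)) hχ,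
    fun C ψ h => hgoal C ⟨ψ, h⟩ ψ h⟩

/-- The worlds in which all the formed coalitions reach their goals. -/
def Compatible (a : Ag → Move Ag P) (t : World Ag P) : Prop :=
  s.Successor t ∧ ∀ C ψ, s.Formed a C ψ → t.holds ψ

theorem exists_compatible_not_holds [Finite Ag] {a : Ag → Move Ag P} {U : Set Ag}
    (hU : ∀ C ψ, s.Formed a C ψ → C ⊆ U) {φ : Formula Ag P} (hφ : ¬ s.holds (eff U φ)) :
    ∃ t, s.Compatible a t ∧ ¬ t.holds φ := by
  obtain ⟨χ, hχ, hgoal⟩ := s.exists_eff_goals a U hU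
  obtain ⟨t, hst, htχ, htφ⟩ := s.exists_successor hχ hφ
  exact ⟨t, ⟨hst, fun C ψ h => t.holds_mp (hgoal C ψ h) htχ⟩, htφ⟩

theorem exists_compatible [Finite Ag] (a : Ag → Move Ag P) : ∃ t, s.Compatible a t := by
  obtain ⟨t, ht, -⟩ := s.exists_compatible_not_holds (a := a) (U := Set.univ)
    (fun C _ _ => Set.subset_univ C) s.not_eff_bot
  exact ⟨t, ht⟩

end World

/-- A voting rule in which every agent can make himself elected, given the other votes. -/
theorem exists_voting_rule (A : Type u) [Finite A] [Nonempty A] :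
    ∃ elect : (A → A) → A, ∀ (f : A → A) (i : A), ∃ x, ∀ g : A → A,
      (∀ j, j ≠ i → g j = f j) → g i = x → elect g = i := by
  classical
  have := Fintype.ofFinite A
  obtain ⟨n, ⟨e⟩⟩ : ∃ n, Nonempty (A ≃ Fin (n + 1)) :=
    ⟨Fintype.card A - 1, ⟨(Fintype.equivFinOfCardEq (by
      have := Fintype.card_pos (α := A)
      omega))⟩⟩
  -- Votes are added in the cyclic group `Fin (n + 1)`; one voter can correct the sum to any value.
  refine ⟨fun f => e.symm (∑ j, e (f j)), fun f i =>
    ⟨e.symm (e i - ∑ j ∈ Finset.univ.erase i, e (f j)), fun g hg hgi => ?_⟩⟩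
  have hsum : ∑ j ∈ Finset.univ.erase i, e (g j) = ∑ j ∈ Finset.univ.erase i, e (f j) :=
    Finset.sum_congr rfl fun j hj => by rw [hg j (Finset.ne_of_mem_erase hj)]
  rw [Equiv.symm_apply_eq, ← Finset.add_sum_erase _ _ (Finset.mem_univ i), hsum, hgi,
    Equiv.apply_symm_apply, sub_add_cancel]

/-! ### The outcome function and the effectivity of coalitions. -/

section Outcome

variable [Finite Ag] [Nonempty Ag]

/-- The leader determined by a profile of votes. -/
noncomputable def elect : (Ag → Ag) → Ag := (exists_voting_rule Ag).choose

theorem elect_spec (f : Ag → Ag) (i : Ag) : ∃ x, ∀ g : Ag → Ag,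
    (∀ j, j ≠ i → g j = f j) → g i = x → elect g = i :=
  (exists_voting_rule Ag).choose_spec f i

namespace World

open Classical in
/-- The outcome function of the canonical game: the leader's target if it is compatible with the
goals of the formed coalitions, and an arbitrary compatible world otherwise. -/
noncomputable def next (s : World Ag P) (a : Ag → Move Ag P) : World Ag P :=
  if s.Compatible a (a (elect fun i => (a i).vote)).target then
    (a (elect fun i => (a i).vote)).target
  else (s.exists_compatible a).choose

theorem compatible_next (s : World Ag P) (a : Ag → Move Ag P) : s.Compatible a (s.next a) := by
  unfold next
  split_ifs with h
  · exact h
  · exact (s.exists_compatible a).choose_spec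

theorem holds_eff_iff (s : World Ag P) (C : Set Ag) (φ : Formula Ag P) :
    s.holds (eff C φ) ↔ ∃ a : Ag → Move Ag P, ∀ b : Ag → Move Ag P, (∀ i ∈ C, b i = a i) →
      (s.next b).holds φ := by
  classical
  constructor
  · intro h
    -- Vote and target are irrelevant here. The empty coalition never counts as formed; its power
    -- comes from `Successor` instead.
    refine ⟨fun _ => ⟨C, φ, Classical.arbitrary Ag, s⟩, fun b hb => ?_⟩
    have hcomp := s.compatible_next b
    rcases C.eq_empty_or_nonempty with rfl | hC
    · exact hcomp.1 φ h
    · exact hcomp.2 C φ ⟨hC, fun i hi => by rw [hb i hi], fun i hi => by rw [hb i hi], h⟩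
  · rintro ⟨a, ha⟩
    by_contra h
    by_cases hC : C = Set.univ
    · subst hC
      exact ((s.next a).isBooleanAssignment.neg_iff φ).1
        ((s.compatible_next a).1 _ (s.eff_empty_neg h)) (ha a fun _ _ => rfl)
    obtain ⟨j, hj⟩ := (Set.ne_univ_iff_exists_notMem C).1 hC
    obtain ⟨x, hx⟩ := elect_spec (fun i => (a i).vote) j
    -- The agents outside `C` join no coalition; `j` is elected and moves to `t`.
    let b : World Ag P → Ag → Move Ag P := fun t i =>
      if i ∈ C then a i else ⟨∅, top, if i = j then x else (a i).vote, t⟩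
    have hbC : ∀ t, ∀ i ∈ C, b t i = a i := fun t i hi => if_pos hi
    have hbn : ∀ t, ∀ i ∉ C, b t i = ⟨∅, top, if i = j then x else (a i).vote, t⟩ :=
      fun t i hi => if_neg hi
    have hsub : ∀ t D ψ, s.Formed (b t) D ψ → D ⊆ C := by
      intro t D ψ hD i hi
      by_contra hiC
      have hDe := hD.coalition_eq i hi
      rw [hbn t i hiC] at hDe
      exact Set.notMem_empty i (hDe.symm.subset hi)
    have hform : ∀ t t' D ψ, s.Formed (b t) D ψ → s.Formed (b t') D ψ := by
      intro t t' D ψ hD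
      have heq : ∀ i ∈ D, b t' i = b t i := fun i hi => by
        rw [hbC t' i (hsub t D ψ hD hi), hbC t i (hsub t D ψ hD hi)]
      exact ⟨hD.nonempty, fun i hi => by rw [heq i hi, hD.coalition_eq i hi],
        fun i hi => by rw [heq i hi, hD.goal_eq i hi], hD.eff⟩
    obtain ⟨t, ht, htφ⟩ := s.exists_compatible_not_holds (hsub s) h
    have helect : elect (fun i => (b t i).vote) = j := by
      refine hx _ (fun i hij => ?_) ?_
      · by_cases hi : i ∈ C
        · simp only [hbC t i hi]
        · simp only [hbn t i hi, if_neg hij]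
      · simp only [hbn t j hj, if_pos]
    have htarget : (b t (elect fun i => (b t i).vote)).target = t := by
      rw [helect, hbn t j hj]
    have hcomp : s.Compatible (b t) t := ⟨ht.1, fun D ψ hD => ht.2 D ψ (hform t s D ψ hD)⟩
    have hnext : s.next (b t) = t := by
      unfold next
      rw [htarget, if_pos hcomp]
    exact htφ (hnext ▸ ha (b t) (hbC t))

end World

end Outcome

end Canonical

/-! ### Universe levels, the canonical model and completeness. -/

section Size

variable {Ag : Type u} {P : Type v}

/-- The nesting depth of a formula. -/
def Formula.depth : Formula Ag P → ℕ
  | .var _ => 0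
  | .neg φ => φ.depth + 1
  | .conj φ ψ => max φ.depth ψ.depth + 1
  | .eff _ φ => φ.depth + 1
  | .iab _ φ => φ.depth + 1

/-- Countable at each depth, since a finite agent set has only finitely many coalitions. Worlds are
sets of formulas, so worlds and moves then fit into any universe, as validity at level `w` demands.
-/
instance [Finite Ag] [Countable P] : Countable (Formula Ag P) := by
  have key : ∀ n, {φ : Formula Ag P | φ.depth < n}.Countable := by
    intro n
    induction n with
    | zero => simp
    | succ n ih =>
      have hmod : ∀ op : Set Ag → Formula Ag P → Formula Ag P,
          (⋃ C, op C '' {φ : Formula Ag P | φ.depth < n}).Countable := fun op =>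
        Set.countable_iUnion fun C => ih.image _
      refine (((((Set.countable_range Formula.var).union (ih.image Formula.neg)).union
        (ih.image2 ih Formula.conj)).union (hmod .eff)).union (hmod .iab)).mono ?_
      intro φ hφ
      rw [Set.mem_ofPred_eq] at hφ
      cases φ with
      | var p => exact .inl (.inl (.inl (.inl ⟨p, rfl⟩)))
      | neg φ =>
        simp only [Formula.depth] at hφ
        exact .inl (.inl (.inl (.inr ⟨φ, by simpa using hφ, rfl⟩)))
      | conj φ ψ =>
        simp only [Formula.depth, Nat.add_lt_add_iff_right, max_lt_iff] at hφ
        exact .inl (.inl (.inr ⟨φ, hφ.1, ψ, hφ.2, rfl⟩))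
      | eff C φ =>
        simp only [Formula.depth] at hφ
        exact .inl (.inr (Set.mem_iUnion.2 ⟨C, φ, by simpa using hφ, rfl⟩))
      | iab C φ =>
        simp only [Formula.depth] at hφ
        exact .inr (Set.mem_iUnion.2 ⟨C, φ, by simpa using hφ, rfl⟩)
  refine Set.countable_univ_iff.1 ((Set.countable_iUnion key).mono fun φ _ => ?_)
  exact Set.mem_iUnion.2 ⟨φ.depth + 1, Nat.lt_succ_self _⟩

variable [Finite Ag] [Countable P] [Nonempty P]

instance : Small.{w} (World Ag P) := small_of_injective World.holds_injective

instance : Small.{w} (Move Ag P) :=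
  small_of_injective (β := Set Ag × Formula Ag P × Ag × World Ag P)
    (f := fun m => (m.coalition, m.goal, m.vote, m.target)) (by
      rintro ⟨⟩ ⟨⟩ h
      simpa using h)

variable [Nonempty Ag]

/-- The canonical model. -/
noncomputable def canonicalModel (s : World Ag P) : CoalitionModel.{u, v, w} Ag P where
  State := Shrink.{w} (World Ag P)
  state_nonempty := ⟨equivShrink _ s⟩
  Act _ := Shrink.{w} (Move Ag P)
  act_nonempty _ := ⟨equivShrink _ ⟨∅, top, Classical.arbitrary Ag, s⟩⟩
  outcome t a := equivShrink _ (((equivShrink _).symm t).next fun i => (equivShrink _).symm (a i))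
  val p := {t | ((equivShrink _).symm t).holds (.var p)}

/-- The states of the canonical model are the worlds. -/
noncomputable def stateEquiv (s : World Ag P) :
    (canonicalModel.{u, v, w} s).State ≃ World Ag P :=
  (equivShrink (World Ag P)).symm

/-- The actions of the canonical model are the moves. -/
noncomputable def actEquiv (s : World Ag P) (i : Ag) :
    (canonicalModel.{u, v, w} s).Act i ≃ Move Ag P :=
  (equivShrink (Move Ag P)).symm

theorem stateEquiv_outcome (s : World Ag P) (t : (canonicalModel.{u, v, w} s).State)
    (a : ∀ i, (canonicalModel.{u, v, w} s).Act i) :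
    stateEquiv s ((canonicalModel s).outcome t a) =
      (stateEquiv s t).next fun i => actEquiv s i (a i) :=
  (equivShrink (World Ag P)).symm_apply_apply _

theorem canonicalModel_sat_eff_iff (s : World Ag P) (C : Set Ag) (φ : Formula Ag P)
    (ih : ∀ t, (canonicalModel.{u, v, w} s).Sat t φ ↔ (stateEquiv s t).holds φ)
    (t : (canonicalModel.{u, v, w} s).State) :
    (canonicalModel.{u, v, w} s).Sat t (eff C φ) ↔ (stateEquiv s t).holds (eff C φ) := by
  rw [CoalitionModel.sat_eff_iff, World.holds_eff_iff]
  simp only [ih, stateEquiv_outcome]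
  constructor
  · rintro ⟨a, ha⟩
    refine ⟨fun i => actEquiv s i (a i), fun b hb => ?_⟩
    have := ha (fun i => (actEquiv s i).symm (b i)) fun i hi => by
      simp [hb i hi]
    simpa using this
  · rintro ⟨a, ha⟩
    exact ⟨fun i => (actEquiv s i).symm (a i), fun b hb => ha _ fun i hi => by simp [hb i hi]⟩

/-- The truth lemma. -/
theorem canonicalModel_sat_iff (s : World Ag P) (φ : Formula Ag P)
    (t : (canonicalModel.{u, v, w} s).State) :
    (canonicalModel.{u, v, w} s).Sat t φ ↔ (stateEquiv s t).holds φ := by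
  induction φ generalizing t with
  | var p =>
    simp only [CoalitionModel.Sat]
    rfl
  | neg φ ih =>
    rw [(CoalitionModel.isBooleanAssignment_sat _ t).neg_iff, ih,
      (World.isBooleanAssignment _).neg_iff]
  | conj φ ψ ih₁ ih₂ =>
    rw [(CoalitionModel.isBooleanAssignment_sat _ t).conj_iff, ih₁, ih₂,
      (World.isBooleanAssignment _).conj_iff]
  | eff C φ ih => exact canonicalModel_sat_eff_iff s C φ ih t
  | iab C φ ih =>
    rw [CoalitionModel.sat_iab_iff, canonicalModel_sat_eff_iff s C φ ih t,
      ← (World.isBooleanAssignment _).neg_iff]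
    exact (((World.isBooleanAssignment _).iff_iff _ _).1
      (World.holds_of_provable _ (.iab_def C φ))).symm

theorem Valid.provable {φ : Formula Ag P} (h : Valid.{u, v, w} φ) : Provable φ := by
  by_contra hφ
  obtain ⟨s, hs⟩ := exists_world_not_holds hφ
  have hsat := (canonicalModel_sat_iff.{u, v, w} s φ _).1 (h _ ((stateEquiv s).symm s))
  rw [Equiv.apply_symm_apply] at hsat
  exact hs hsat

end Size

end CoalitionLogic

theorem theorem3 {Ag : Type u} [Finite Ag] [Nonempty Ag] {P : Type v} [Countable P] [Nonempty P]
    (φ : CoalitionLogic.Formula Ag P) :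
    CoalitionLogic.Provable φ ↔ CoalitionLogic.Valid.{u, v, w} φ :=
  ⟨CoalitionLogic.Provable.valid, CoalitionLogic.Valid.provable⟩
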